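/- Let $n\ge 2$, $\mathcal N=\{1,\dots,n\}$, and let $\mathcal N'=\{1',\dots,n'\}$ be a disjoint copy of $\mathcal N$. Let $\overline{\mathcal{PI}^{\ast}}_n$ be the set of all partitions of $\mathcal N\cup\mathcal N'$ each of whose blocks is either a point (a one-element set) or a generalised line (a block meeting both $\mathcal N$ and $\mathcal N'$), with the following associative multiplication $\circ$: the generalised lines of $\alpha\circ\beta$ are exactly the sets $(A\cap\mathcal N)\cup(B\cap\mathcal N')$, where $A$ is a generalised line of $\alpha$ and $B$ is a generalised line of $\beta$ with $A\cap\mathcal N'=(B\cap\mathcal N)'$; all other blocks of $\alpha\circ\beta$ are points. Identify a permutation $g$ of $\mathcal N$ with the partition whose blocks are $\{x,g(x)'\}$, $x\in\mathcal N$, so that the symmetric group $\mathcal S_n$ is contained in $\overline{\mathcal{PI}^{\ast}}_n$. For an idempotent $e$, let $G(e)$ be the maximal subgroup of $\overline{\mathcal{PI}^{\ast}}_n$ with identity element $e$, and let $\mathrm{corank}(e)$ be the number of $x\in\mathcal N$ that lie in no generalised line of $e$. A non-empty subset $T$ of a semigroup $S$ that is closed under multiplication is called an isolated subsemigroup of $S$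 if, for all $a\in S$ and $k\ge1$, $a^k\in T$ implies $a\in T$. Theorem. A subset of $\overline{\mathcal{PI}^{\ast}}_n$ is an isolated subsemigroup of $\overline{\mathcal{PI}^{\ast}}_n$ if and only if it is one of $\overline{\mathcal{PI}^{\ast}}_n$, $\mathcal S_n$, $\overline{\mathcal{PI}^{\ast}}_n\setminus\mathcal S_n$, or $G(e)$ for an idempotent $e$ with $\mathrm{corank}(e)\le 1$. -/

import Mathlib

/-- The carrier: partitions of `X ∪ X'`, each block of which is a point (a singleton) or a generalised
line (a block meeting both `X` and `X'`). A disjoint copy `X'` of `X` is realised by the sum type: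
`Sum.inl x` is the top vertex `x`, `Sum.inr x` is the bottom vertex `x'`. -/
structure PIBar (X : Type*) where
  /-- the equivalence relation whose classes are the blocks -/
  rel : Setoid (X ⊕ X)
  point_or_line : ∀ A ∈ rel.classes,
    (∃ p, A = {p}) ∨ ((∃ x, Sum.inl x ∈ A) ∧ (∃ y, Sum.inr y ∈ A))

namespace PIBar

variable {X : Type*}

/-- The set of blocks of `α`. -/
def blocks (α : PIBar X) : Set (Set (X ⊕ X)) := α.rel.classes

/-- The set of generalised lines of `α`: the blocks meeting both `X` and `X'`. -/
def lines (α : PIBar X) : Set (Set (X ⊕ X)) :=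
  {A | A ∈ α.blocks ∧ (∃ x, Sum.inl x ∈ A) ∧ (∃ y, Sum.inr y ∈ A)}

/-- The partition with a prescribed family `L` of pairwise disjoint generalised lines, all the other
blocks being points. -/
def ofLines (L : Set (Set (X ⊕ X)))
    (hd : ∀ A ∈ L, ∀ B ∈ L, ∀ p, p ∈ A → p ∈ B → A = B)
    (hl : ∀ A ∈ L, (∃ x, Sum.inl x ∈ A) ∧ (∃ y, Sum.inr y ∈ A)) : PIBar X where
  rel :=
    { r := fun p q => p = q ∨ ∃ A ∈ L, p ∈ A ∧ q ∈ A
      iseqv :=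
        { refl := fun _ => Or.inl rfl
          symm := by
            rintro p q (h | ⟨A, hA, hp, hq⟩)
            · exact Or.inl h.symm
            · exact Or.inr ⟨A, hA, hq, hp⟩
          trans := by
            rintro p q r (rfl | ⟨A, hA, hp, hq⟩) (rfl | ⟨B, hB, hq', hr⟩)
            · exact Or.inl rfl
            · exact Or.inr ⟨B, hB, hq', hr⟩
            · exact Or.inr ⟨A, hA, hp, hq⟩
            · obtain rfl := hd A hA B hB q hq hq'
              exact Or.inr ⟨A, hA, hp, hr⟩ } }
  point_or_line := by
    rintro C ⟨p, rfl⟩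
    by_cases h : ∃ A ∈ L, p ∈ A
    · obtain ⟨A, hA, hp⟩ := h
      obtain ⟨⟨x, hx⟩, ⟨y, hy⟩⟩ := hl A hA
      exact Or.inr ⟨⟨x, Or.inr ⟨A, hA, hx, hp⟩⟩, ⟨y, Or.inr ⟨A, hA, hy, hp⟩⟩⟩
    · refine Or.inl ⟨p, ?_⟩
      ext q
      constructor
      · rintro (h' | ⟨A, hA, _, hp⟩)
        · exact h'
        · exact absurd ⟨A, hA, hp⟩ h
      · rintro rfl
        exact Or.inl rfl

theorem lines_ofLines (L : Set (Set (X ⊕ X)))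
    (hd : ∀ A ∈ L, ∀ B ∈ L, ∀ p, p ∈ A → p ∈ B → A = B)
    (hl : ∀ A ∈ L, (∃ x, Sum.inl x ∈ A) ∧ (∃ y, Sum.inr y ∈ A)) :
    (ofLines L hd hl).lines = L := by
  have key : ∀ A ∈ L, ∀ p ∈ A, {q | (ofLines L hd hl).rel q p} = A := by
    intro A hA p hp
    ext q
    constructor
    · rintro (h | ⟨B, hB, hq, hp'⟩)
      · rwa [h]
      · rwa [hd A hA B hB p hp hp']
    · exact fun hq => Or.inr ⟨A, hA, hq, hp⟩
  ext C
  constructor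
  · rintro ⟨⟨p, rfl⟩, ⟨x, hx⟩, ⟨y, hy⟩⟩
    rcases hx with hx | ⟨A, hA, _, hp⟩
    · rcases hy with hy | ⟨A, hA, _, hp⟩
      · rw [← hx] at hy
        exact absurd hy (by simp)
      · rw [key A hA p hp]; exact hA
    · rw [key A hA p hp]; exact hA
  · intro hC
    obtain ⟨⟨x, hx⟩, ⟨y, hy⟩⟩ := hl C hC
    exact ⟨⟨Sum.inl x, (key C hC _ hx).symm⟩, ⟨x, hx⟩, ⟨y, hy⟩⟩

theorem lines_disjoint (α : PIBar X) :
    ∀ A ∈ α.lines, ∀ B ∈ α.lines, ∀ p, p ∈ A → p ∈ B → A = B :=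
  fun _ hA _ hB _ hpA hpB => Setoid.eq_of_mem_classes hA.1 hpA hB.1 hpB

theorem rel_iff_lines (α : PIBar X) (p q : X ⊕ X) :
    α.rel p q ↔ p = q ∨ ∃ A ∈ α.lines, p ∈ A ∧ q ∈ A := by
  constructor
  · intro h
    have hc : {r | α.rel r q} ∈ α.rel.classes := ⟨q, rfl⟩
    rcases α.point_or_line _ hc with ⟨r, hr⟩ | hl
    · have hp : p ∈ ({r} : Set (X ⊕ X)) := hr ▸ (show p ∈ {r | α.rel r q} from h)
      have hq : q ∈ ({r} : Set (X ⊕ X)) :=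
        hr ▸ (show q ∈ {r | α.rel r q} from α.rel.refl q)
      exact Or.inl (hp.trans hq.symm)
    · exact Or.inr ⟨_, ⟨hc, hl⟩, h, α.rel.refl q⟩
  · rintro (rfl | ⟨A, ⟨⟨r, rfl⟩, _⟩, hp, hq⟩)
    · exact α.rel.refl p
    · exact α.rel.trans hp (α.rel.symm hq)

theorem ext_lines {α β : PIBar X} (h : α.lines = β.lines) : α = β := by
  have hr : α.rel = β.rel := by
    ext p q
    rw [rel_iff_lines, rel_iff_lines, h]
  cases α
  cases β
  cases hr
  rfl

/-- For a generalised line `A` of the first factor and a generalised line `B` of the second one, the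
generalised line `(A ∩ X) ∪ (B ∩ X')`. -/
def glue (A B : Set (X ⊕ X)) : Set (X ⊕ X) :=
  Sum.inl '' (Sum.inl ⁻¹' A) ∪ Sum.inr '' (Sum.inr ⁻¹' B)

@[simp] theorem inl_mem_glue (A B : Set (X ⊕ X)) (x : X) :
    Sum.inl x ∈ glue A B ↔ Sum.inl x ∈ A := by simp [glue]

@[simp] theorem inr_mem_glue (A B : Set (X ⊕ X)) (x : X) :
    Sum.inr x ∈ glue A B ↔ Sum.inr x ∈ B := by simp [glue]

@[simp] theorem inl_preimage_glue (A B : Set (X ⊕ X)) :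
    Sum.inl ⁻¹' glue A B = Sum.inl ⁻¹' A := by ext; simp

@[simp] theorem inr_preimage_glue (A B : Set (X ⊕ X)) :
    Sum.inr ⁻¹' glue A B = Sum.inr ⁻¹' B := by ext; simp

theorem glue_glue_left (A B C : Set (X ⊕ X)) : glue (glue A B) C = glue A C := by
  rw [glue, inl_preimage_glue, ← glue.eq_1]

theorem glue_glue_right (A B C : Set (X ⊕ X)) : glue A (glue B C) = glue A C := by
  rw [glue, inr_preimage_glue, ← glue.eq_1]

/-- The generalised lines of `α ∘ β`: the sets `(A ∩ X) ∪ (B ∩ X')`, where `A`, `B` are generalised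
lines of `α`, `β` with `A ∩ X' = (B ∩ X)'`. -/
def mulLines (α β : PIBar X) : Set (Set (X ⊕ X)) :=
  {C | ∃ A ∈ α.lines, ∃ B ∈ β.lines, Sum.inr ⁻¹' A = Sum.inl ⁻¹' B ∧ C = glue A B}

/-- The operation `∘`. -/
instance : Mul (PIBar X) where
  mul α β := ofLines (mulLines α β)
    (by
      rintro _ ⟨A, hA, B, hB, hAB, rfl⟩ _ ⟨A', hA', B', hB', hAB', rfl⟩ p hp hp'
      obtain ⟨y, hy⟩ := hA.2.2
      obtain ⟨x, hx⟩ := hB.2.1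
      have hxA : x ∈ Sum.inr ⁻¹' A := hAB ▸ (show x ∈ Sum.inl ⁻¹' B from hx)
      have hyB : y ∈ Sum.inl ⁻¹' B := hAB ▸ (show y ∈ Sum.inr ⁻¹' A from hy)
      rcases p with p | p
      · rw [inl_mem_glue] at hp hp'
        obtain rfl := α.lines_disjoint A hA A' hA' _ hp hp'
        have hyB' : y ∈ Sum.inl ⁻¹' B' := hAB' ▸ (show y ∈ Sum.inr ⁻¹' A from hy)
        obtain rfl := β.lines_disjoint B hB B' hB' _ hyB hyB'
        rfl
      · rw [inr_mem_glue] at hp hp'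
        obtain rfl := β.lines_disjoint B hB B' hB' _ hp hp'
        have hxA' : x ∈ Sum.inr ⁻¹' A' := hAB' ▸ (show x ∈ Sum.inl ⁻¹' B from hx)
        obtain rfl := α.lines_disjoint A hA A' hA' _ hxA hxA'
        rfl)
    (by
      rintro _ ⟨A, hA, B, hB, -, rfl⟩
      obtain ⟨x, hx⟩ := hA.2.1
      obtain ⟨y, hy⟩ := hB.2.2
      exact ⟨⟨x, by simpa using hx⟩, ⟨y, by simpa using hy⟩⟩)

theorem lines_mul (α β : PIBar X) : (α * β).lines = mulLines α β := lines_ofLines _ _ _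

/-- The characterisation of the product: `i ≡ j'` in `α ∘ β` if and only if `i` lies in a generalised
line `A` of `α` and `j'` in a generalised line `B` of `β` with `A ∩ X' = (B ∩ X)'`. -/
theorem mul_rel_inl_inr (α β : PIBar X) (i j : X) :
    (α * β).rel (Sum.inl i) (Sum.inr j) ↔
      ∃ A ∈ α.lines, ∃ B ∈ β.lines,
        Sum.inl i ∈ A ∧ Sum.inr j ∈ B ∧ Sum.inr ⁻¹' A = Sum.inl ⁻¹' B := by
  rw [rel_iff_lines, lines_mul]
  constructor
  · rintro (h | ⟨_, ⟨A, hA, B, hB, hAB, rfl⟩, hi, hj⟩)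
    · exact absurd h (by simp)
    · exact ⟨A, hA, B, hB, by simpa using hi, by simpa using hj, hAB⟩
  · rintro ⟨A, hA, B, hB, hi, hj, hAB⟩
    exact Or.inr ⟨_, ⟨A, hA, B, hB, hAB, rfl⟩, by simpa using hi, by simpa using hj⟩

/-- The semigroup of the partitions above under the operation `∘`. -/
instance : Semigroup (PIBar X) where
  mul_assoc α β γ := by
    apply ext_lines
    ext D
    simp only [lines_mul, mulLines, Set.mem_ofPred_eq]
    constructor
    · rintro ⟨_, ⟨A, hA, B, hB, hAB, rfl⟩, C, hC, hBC, rfl⟩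
      rw [inr_preimage_glue] at hBC
      refine ⟨A, hA, _, ⟨B, hB, C, hC, hBC, rfl⟩, ?_, ?_⟩
      · rw [inl_preimage_glue, hAB]
      · simp only [glue_glue_left, glue_glue_right]
    · rintro ⟨A, hA, _, ⟨B, hB, C, hC, hBC, rfl⟩, hAB, rfl⟩
      rw [inl_preimage_glue] at hAB
      refine ⟨_, ⟨A, hA, B, hB, hAB, rfl⟩, C, hC, ?_, ?_⟩
      · rw [inr_preimage_glue, hBC]
      · simp only [glue_glue_left, glue_glue_right]

/-- The set `codom α` of the elements of `X` that lie in no generalised line of `α`. -/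
def codom (α : PIBar X) : Set X := {x | ∀ A ∈ α.lines, Sum.inl x ∉ A}

/-- The set of the `x` in `X` such that `x'` lies in no generalised line of `α`. -/
def coran (α : PIBar X) : Set X := {x | ∀ A ∈ α.lines, Sum.inr x ∉ A}

theorem codom_eq_coran_of_idempotent {e : PIBar X} (he : e * e = e) : e.codom = e.coran := by
  have key : ∀ A ∈ e.lines, (Sum.inl ⁻¹' A : Set X) = Sum.inr ⁻¹' A := by
    intro A hA
    have hA' : A ∈ mulLines e e := by rw [← lines_mul, he]; exact hA
    obtain ⟨B, hB, C, hC, hBC, h⟩ := hA'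
    obtain ⟨x, hx⟩ := hA.2.1
    obtain ⟨y, hy⟩ := hA.2.2
    have hAB : A = B := e.lines_disjoint A hA B hB (Sum.inl x) hx (by rw [h] at hx; simpa using hx)
    have hAC : A = C := e.lines_disjoint A hA C hC (Sum.inr y) hy (by rw [h] at hy; simpa using hy)
    rw [← hAB, ← hAC] at hBC
    exact hBC.symm
  ext x
  have h : ∀ A ∈ e.lines, (Sum.inl x ∈ A ↔ Sum.inr x ∈ A) := fun A hA =>
    Set.ext_iff.mp (key A hA) x
  exact forall₂_congr fun A hA => not_congr (h A hA)

/-- The corank of an idempotent (for an idempotent, `codom` and `coran` agree up to priming). -/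
noncomputable def corank (e : PIBar X) : ℕ := e.codom.ncard

/-- The symmetric group inside the semigroup: a permutation `g` of `X` is identified with the
partition whose blocks are the lines `{x, g(x)'}`. -/
def symmGroup (X : Type*) : Set (PIBar X) :=
  {α | ∃ g : Equiv.Perm X, α.blocks = Set.range fun x => {Sum.inl x, Sum.inr (g x)}}

end PIBar

/-- `posPow a k` is the power `a ^ (k + 1)` in a semigroup. -/
def posPow {S : Type*} [Semigroup S] (a : S) : ℕ → S
  | 0 => a
  | k + 1 => posPow a k * a

/-- `T` is an isolated subsemigroup of `S`: a non-empty subset closed under multiplication, such that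
`a ^ k ∈ T` for some `k ≥ 1` implies `a ∈ T`. -/
def IsIsolatedSubsemigroup {S : Type*} [Semigroup S] (T : Set S) : Prop :=
  T.Nonempty ∧ (∀ a ∈ T, ∀ b ∈ T, a * b ∈ T) ∧ ∀ (a : S) (k : ℕ), posPow a k ∈ T → a ∈ T

/-- `G(e)`, the maximal subgroup with identity element `e` (for an idempotent `e`): the group of units
of the monoid `eSe`. -/
def maximalSubgroup {S : Type*} [Semigroup S] (e : S) : Set S :=
  {a | e * a = a ∧ a * e = a ∧ ∃ b, e * b = b ∧ b * e = b ∧ a * b = e ∧ b * a = e}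

/-! ### Elements as partial bijections between families of disjoint sets -/

namespace PIBar

variable {X : Type*}

/-! An element is a partial bijection `A ↦ B` on non-empty subsets whose domain and range are
families of pairwise disjoint sets; the product is composition. Idempotents are identities on
families and multiply by intersection, and G(idem E) consists of the elements with domain and range
E. By finiteness every element has an idempotent power, so an isolated T is determined by its
idempotents, and these have a least family E.

Two moves produce new idempotents. Growing (`idem_insert_mem`): sending A to some B outside and
fixing E gives a square root of `idem E`, as does its converse; their product is the idempotent of E
with A added. Shrinking (`idem_diff_singleton_mem`): if F strictly contains E, a transposition of a
block of E with one of F \ E is a square root of `idem F`, and it removes a block from E.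

If E is empty, growing reaches every family except that of all singletons, so T is everything or the
complement of the symmetric group. If E is non-empty, shrinking forces E to be the only family, and
growing forbids two uncovered points, so T = G(idem E) with corank at most 1. Conversely such a G(e)
is isolated, because a root of one of its elements has room for at most one extra block on each
side, necessarily the same one. -/

/-- The line with upper part `A` and lower part `B`. -/
def segment (A B : Set X) : Set (X ⊕ X) := Sum.inl '' A ∪ Sum.inr '' B

@[simp] theorem inl_mem_segment (A B : Set X) (x : X) : Sum.inl x ∈ segment A B ↔ x ∈ A := by
  simp [segment]

@[simp] theorem inr_mem_segment (A B : Set X) (x : X) : Sum.inr x ∈ segment A B ↔ x ∈ B := by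
  simp [segment]

@[simp] theorem inl_preimage_segment (A B : Set X) : Sum.inl ⁻¹' segment A B = A := by ext; simp

@[simp] theorem inr_preimage_segment (A B : Set X) : Sum.inr ⁻¹' segment A B = B := by ext; simp

theorem segment_preimage (C : Set (X ⊕ X)) : segment (Sum.inl ⁻¹' C) (Sum.inr ⁻¹' C) = C := by
  ext (x | x) <;> simp

theorem segment_inj {A B A' B' : Set X} : segment A B = segment A' B' ↔ A = A' ∧ B = B' := by
  refine ⟨fun h => ⟨?_, ?_⟩, by rintro ⟨rfl, rfl⟩; rfl⟩
  · simpa using congrArg (Sum.inl ⁻¹' ·) h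
  · simpa using congrArg (Sum.inr ⁻¹' ·) h

/-- `α.Joins A B`: the subset `A ∪ B'` is a generalised line of `α`. -/
def Joins (α : PIBar X) (A B : Set X) : Prop := segment A B ∈ α.lines

/-- The relations between subsets of `X` that come from elements of `PIBar X`. -/
structure IsLineRel (R : Set X → Set X → Prop) : Prop where
  left_nonempty : ∀ {A B}, R A B → A.Nonempty
  right_nonempty : ∀ {A B}, R A B → B.Nonempty
  of_left : ∀ {A B A' B' x}, R A B → R A' B' → x ∈ A → x ∈ A' → A = A' ∧ B = B'
  of_right : ∀ {A B A' B' x}, R A B → R A' B' → x ∈ B → x ∈ B' → A = A' ∧ B = B'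

theorem isLineRel_joins (α : PIBar X) : IsLineRel α.Joins where
  left_nonempty h := by obtain ⟨x, hx⟩ := h.2.1; exact ⟨x, by simpa using hx⟩
  right_nonempty h := by obtain ⟨x, hx⟩ := h.2.2; exact ⟨x, by simpa using hx⟩
  of_left h h' hx hx' := segment_inj.1 <| α.lines_disjoint _ h _ h' _
    ((inl_mem_segment _ _ _).2 hx) ((inl_mem_segment _ _ _).2 hx')
  of_right h h' hx hx' := segment_inj.1 <| α.lines_disjoint _ h _ h' _
    ((inr_mem_segment _ _ _).2 hx) ((inr_mem_segment _ _ _).2 hx')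

theorem Joins.eq_right {α : PIBar X} {A B B' : Set X} (h : α.Joins A B) (h' : α.Joins A B') :
    B = B' := by
  obtain ⟨x, hx⟩ := α.isLineRel_joins.left_nonempty h
  exact (α.isLineRel_joins.of_left h h' hx hx).2

theorem Joins.eq_left {α : PIBar X} {A A' B : Set X} (h : α.Joins A B) (h' : α.Joins A' B) :
    A = A' := by
  obtain ⟨x, hx⟩ := α.isLineRel_joins.right_nonempty h
  exact (α.isLineRel_joins.of_right h h' hx hx).1

theorem mem_lines_iff {α : PIBar X} {C : Set (X ⊕ X)} :
    C ∈ α.lines ↔ α.Joins (Sum.inl ⁻¹' C) (Sum.inr ⁻¹' C) := by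
  rw [Joins, segment_preimage]

theorem ext_joins {α β : PIBar X} (h : ∀ A B, α.Joins A B ↔ β.Joins A B) : α = β :=
  ext_lines <| by ext C; rw [mem_lines_iff, mem_lines_iff, h]

theorem joins_mul {α β : PIBar X} {A C : Set X} :
    (α * β).Joins A C ↔ ∃ B, α.Joins A B ∧ β.Joins B C := by
  rw [Joins, lines_mul]
  constructor
  · rintro ⟨P, hP, Q, hQ, hPQ, h⟩
    change _ = segment _ _ at h
    obtain ⟨rfl, rfl⟩ := segment_inj.1 h
    refine ⟨Sum.inr ⁻¹' P, mem_lines_iff.1 hP, ?_⟩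
    rw [hPQ]
    exact mem_lines_iff.1 hQ
  · rintro ⟨B, h, h'⟩
    refine ⟨_, h, _, h', by simp, ?_⟩
    change _ = segment _ _
    simp

/-- The element of `PIBar X` with prescribed lines. -/
def ofRel (R : Set X → Set X → Prop) (hR : IsLineRel R) : PIBar X :=
  ofLines {C | R (Sum.inl ⁻¹' C) (Sum.inr ⁻¹' C)}
    (by
      rintro C hC D hD (x | x) hx hx'
      · obtain ⟨h₁, h₂⟩ := hR.of_left (x := x) hC hD hx hx'
        rw [← segment_preimage C, ← segment_preimage D, h₁, h₂]
      · obtain ⟨h₁, h₂⟩ := hR.of_right (x := x) hC hD hx hx'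
        rw [← segment_preimage C, ← segment_preimage D, h₁, h₂])
    (fun _ hC => ⟨hR.left_nonempty hC, hR.right_nonempty hC⟩)

@[simp] theorem joins_ofRel {R : Set X → Set X → Prop} (hR : IsLineRel R) {A B : Set X} :
    (ofRel R hR).Joins A B ↔ R A B := by
  rw [Joins, ofRel, lines_ofLines]
  simp

/-- A family of pairwise disjoint non-empty sets. -/
structure IsFamily (F : Set (Set X)) : Prop where
  nonempty : ∀ {A}, A ∈ F → A.Nonempty
  eq_of_mem : ∀ {A B x}, A ∈ F → B ∈ F → x ∈ A → x ∈ B → A = B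

theorem IsFamily.mono {E F : Set (Set X)} (hF : IsFamily F) (h : E ⊆ F) : IsFamily E :=
  ⟨fun hA => hF.nonempty (h hA), fun hA hB => hF.eq_of_mem (h hA) (h hB)⟩

theorem IsFamily.insert_of_disjoint {E : Set (Set X)} (hE : IsFamily E) {A : Set X} (hA : A.Nonempty)
    (h : ∀ x ∈ A, ∀ B ∈ E, x ∉ B) : IsFamily (insert A E) where
  nonempty := by
    rintro B (rfl | hB)
    exacts [hA, hE.nonempty hB]
  eq_of_mem := by
    rintro B C x (rfl | hB) (rfl | hC) hx hx'
    · rfl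
    · exact absurd hx' (h x hx C hC)
    · exact absurd hx (h x hx' B hB)
    · exact hE.eq_of_mem hB hC hx hx'

theorem isFamily_empty : IsFamily (∅ : Set (Set X)) := ⟨fun h => h.elim, fun h => h.elim⟩

theorem IsFamily.isLineRel {F : Set (Set X)} (hF : IsFamily F) {f : Set X → Set X}
    (hf : Set.InjOn f F) (hF' : IsFamily (f '' F)) : IsLineRel fun A B => A ∈ F ∧ f A = B where
  left_nonempty h := hF.nonempty h.1
  right_nonempty := by
    rintro A _ ⟨hA, rfl⟩
    exact hF'.nonempty ⟨A, hA, rfl⟩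
  of_left := by
    rintro A _ A' _ x ⟨hA, rfl⟩ ⟨hA', rfl⟩ hx hx'
    obtain rfl := hF.eq_of_mem hA hA' hx hx'
    exact ⟨rfl, rfl⟩
  of_right := by
    rintro A _ A' _ x ⟨hA, rfl⟩ ⟨hA', rfl⟩ hx hx'
    have h := hF'.eq_of_mem ⟨A, hA, rfl⟩ ⟨A', hA', rfl⟩ hx hx'
    exact ⟨hf hA hA' h, h⟩

/-- The idempotent whose lines are the sets `A ∪ A'` with `A` in a given family. -/
def idem (F : Set (Set X)) (hF : IsFamily F) : PIBar X :=
  ofRel (fun A B => A ∈ F ∧ A = B) (hF.isLineRel (f := id) (Set.injOn_id F) (by simpa using hF))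

@[simp] theorem joins_idem {F : Set (Set X)} (hF : IsFamily F) {A B : Set X} :
    (idem F hF).Joins A B ↔ A ∈ F ∧ A = B := joins_ofRel _

/-- Only blocks common to both families survive, so idempotents form a meet-semilattice. -/
theorem idem_mul_idem {E F : Set (Set X)} (hE : IsFamily E) (hF : IsFamily F) :
    idem E hE * idem F hF = idem (E ∩ F) (hE.mono Set.inter_subset_left) :=
  ext_joins fun A B => by
    simp only [joins_mul, joins_idem, Set.mem_inter_iff]
    grind

theorem isIdempotentElem_idem {E : Set (Set X)} (hE : IsFamily E) :
    IsIdempotentElem (idem E hE) := by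
  rw [IsIdempotentElem, idem_mul_idem]
  congr 1
  exact Set.inter_self E

/-- The upper parts of the lines. -/
def dom (α : PIBar X) : Set (Set X) := {A | ∃ B, α.Joins A B}

/-- The lower parts of the lines. -/
def ran (α : PIBar X) : Set (Set X) := {B | ∃ A, α.Joins A B}

theorem isFamily_dom (α : PIBar X) : IsFamily α.dom where
  nonempty := fun ⟨_, h⟩ => α.isLineRel_joins.left_nonempty h
  eq_of_mem := fun ⟨_, h⟩ ⟨_, h'⟩ hx hx' => (α.isLineRel_joins.of_left h h' hx hx').1

theorem isFamily_ran (α : PIBar X) : IsFamily α.ran where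
  nonempty := fun ⟨_, h⟩ => α.isLineRel_joins.right_nonempty h
  eq_of_mem := fun ⟨_, h⟩ ⟨_, h'⟩ hx hx' => (α.isLineRel_joins.of_right h h' hx hx').2

@[simp] theorem dom_idem {E : Set (Set X)} (hE : IsFamily E) : (idem E hE).dom = E := by
  ext A; simp [dom]

theorem eq_idem_dom {e : PIBar X} (he : IsIdempotentElem e) : e = idem e.dom e.isFamily_dom := by
  -- Factoring a line A → B through `e * e` gives A → B → B, so injectivity forces A = B.
  have key : ∀ A B, e.Joins A B → A = B := by
    intro A B h
    have h' := h
    rw [← he.eq, joins_mul] at h'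
    obtain ⟨C, hAC, hCB⟩ := h'
    obtain rfl := h.eq_right hAC
    exact h.eq_left hCB
  refine ext_joins fun A B => ?_
  rw [joins_idem]
  constructor
  · exact fun h => ⟨⟨B, h⟩, key _ _ h⟩
  · rintro ⟨⟨C, h⟩, rfl⟩
    rwa [← key _ _ h] at h

theorem ncard_dom (α : PIBar X) : α.dom.ncard = α.ran.ncard :=
  Set.ncard_congr (fun _ hA => hA.choose) (fun A hA => ⟨A, hA.choose_spec⟩)
    (fun A B hA hB h => by
      have h' := hA.choose_spec
      rw [h] at h'
      exact h'.eq_left hB.choose_spec)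
    (fun B ⟨A, h⟩ => ⟨A, ⟨B, h⟩, Joins.eq_right (Exists.choose_spec (⟨B, h⟩ : ∃ B, _)) h⟩)

theorem dom_mul_subset (α β : PIBar X) : (α * β).dom ⊆ α.dom := by
  rintro A ⟨C, h⟩
  obtain ⟨B, h, -⟩ := joins_mul.1 h
  exact ⟨B, h⟩

theorem ran_mul_subset (α β : PIBar X) : (α * β).ran ⊆ β.ran := by
  rintro C ⟨A, h⟩
  obtain ⟨B, -, h⟩ := joins_mul.1 h
  exact ⟨B, h⟩

theorem ran_posPow_subset (α : PIBar X) : ∀ k, (posPow α k).ran ⊆ α.ran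
  | 0 => subset_rfl
  | _ + 1 => ran_mul_subset _ _

theorem dom_posPow_subset (α : PIBar X) : ∀ k, (posPow α k).dom ⊆ α.dom
  | 0 => subset_rfl
  | k + 1 => (dom_mul_subset _ _).trans (dom_posPow_subset α k)

/-- The element with the lines of `α` turned upside down. -/
def converse (α : PIBar X) : PIBar X :=
  ofRel (fun A B => α.Joins B A)
    { left_nonempty := α.isLineRel_joins.right_nonempty
      right_nonempty := α.isLineRel_joins.left_nonempty
      of_left := fun h h' hx hx' => (α.isLineRel_joins.of_right h h' hx hx').symm
      of_right := fun h h' hx hx' => (α.isLineRel_joins.of_left h h' hx hx').symm }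

@[simp] theorem joins_converse {α : PIBar X} {A B : Set X} :
    α.converse.Joins A B ↔ α.Joins B A := joins_ofRel _

theorem mul_converse (α : PIBar X) : α * α.converse = idem α.dom α.isFamily_dom :=
  ext_joins fun A C => by
    simp only [joins_mul, joins_converse, joins_idem]
    constructor
    · rintro ⟨B, h, h'⟩
      exact ⟨⟨B, h⟩, h.eq_left h'⟩
    · rintro ⟨⟨B, h⟩, rfl⟩
      exact ⟨B, h, h⟩

theorem converse_mul (α : PIBar X) : α.converse * α = idem α.ran α.isFamily_ran :=
  ext_joins fun A C => by
    simp only [joins_mul, joins_converse, joins_idem]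
    constructor
    · rintro ⟨B, h, h'⟩
      exact ⟨⟨B, h⟩, h.eq_right h'⟩
    · rintro ⟨⟨B, h⟩, rfl⟩
      exact ⟨B, h, h⟩

theorem idem_mul_eq_self {E : Set (Set X)} (hE : IsFamily E) {α : PIBar X} (h : α.dom ⊆ E) :
    idem E hE * α = α :=
  ext_joins fun A C => by
    simp only [joins_mul, joins_idem]
    constructor
    · rintro ⟨_, ⟨-, rfl⟩, h'⟩
      exact h'
    · exact fun h' => ⟨A, ⟨h ⟨C, h'⟩, rfl⟩, h'⟩

theorem mul_idem_eq_self {E : Set (Set X)} (hE : IsFamily E) {α : PIBar X} (h : α.ran ⊆ E) :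
    α * idem E hE = α :=
  ext_joins fun A C => by
    simp only [joins_mul, joins_idem]
    constructor
    · rintro ⟨_, h', -, rfl⟩
      exact h'
    · exact fun h' => ⟨C, h', h ⟨A, h'⟩, rfl⟩

@[simp] theorem dom_converse (α : PIBar X) : α.converse.dom = α.ran := by ext; simp [dom, ran]

@[simp] theorem ran_converse (α : PIBar X) : α.converse.ran = α.dom := by ext; simp [dom, ran]

@[simp] theorem ran_idem {E : Set (Set X)} (hE : IsFamily E) : (idem E hE).ran = E := by
  ext A; simp [ran]

theorem mem_maximalSubgroup_idem {E : Set (Set X)} (hE : IsFamily E) {α : PIBar X} :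
    α ∈ maximalSubgroup (idem E hE) ↔ α.dom = E ∧ α.ran = E := by
  constructor
  · rintro ⟨h₁, h₂, β, -, -, h₃, h₄⟩
    refine ⟨subset_antisymm ?_ ?_, subset_antisymm ?_ ?_⟩
    · simpa [h₁] using dom_mul_subset (idem E hE) α
    · simpa [h₃] using dom_mul_subset α β
    · simpa [h₂] using ran_mul_subset α (idem E hE)
    · simpa [h₄] using ran_mul_subset β α
  · rintro ⟨h₁, h₂⟩
    refine ⟨idem_mul_eq_self _ h₁.subset, mul_idem_eq_self _ h₂.subset, α.converse,
      idem_mul_eq_self _ ?_, mul_idem_eq_self _ ?_, ?_, ?_⟩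
    · simp [h₂]
    · simp [h₁]
    · simp only [mul_converse, h₁]
    · simp only [converse_mul, h₂]

end PIBar

/-! ### Powers and maximal subgroups in a semigroup -/

section Semigroup

variable {S : Type*} [Semigroup S]

theorem mul_mem_maximalSubgroup {e a b : S} (ha : a ∈ maximalSubgroup e)
    (hb : b ∈ maximalSubgroup e) : a * b ∈ maximalSubgroup e := by
  obtain ⟨ha₁, ha₂, a', ha₃, ha₄, ha₅, ha₆⟩ := ha
  obtain ⟨hb₁, hb₂, b', hb₃, hb₄, hb₅, hb₆⟩ := hb
  refine ⟨by rw [← mul_assoc, ha₁], by rw [mul_assoc, hb₂], b' * a', by rw [← mul_assoc, hb₃],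
    by rw [mul_assoc, ha₄], ?_, ?_⟩
  · rw [mul_assoc, ← mul_assoc b, hb₅, ha₃, ha₅]
  · rw [mul_assoc, ← mul_assoc a', ha₆, hb₁, hb₆]

theorem posPow_mem {T : Set S} (hT : ∀ a ∈ T, ∀ b ∈ T, a * b ∈ T) {a : S} (ha : a ∈ T) :
    ∀ k, posPow a k ∈ T
  | 0 => ha
  | k + 1 => hT _ (posPow_mem hT ha k) _ ha

theorem posPow_mul_posPow (a : S) (i : ℕ) : ∀ j, posPow a i * posPow a j = posPow a (i + j + 1)
  | 0 => rfl
  | j + 1 => by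
    change posPow a i * (posPow a j * a) = posPow a (i + j + 1) * a
    rw [← mul_assoc, posPow_mul_posPow a i j]

theorem exists_isIdempotentElem_posPow [Finite S] (a : S) :
    ∃ k, IsIdempotentElem (posPow a k) := by
  obtain ⟨i, j, hne, hij⟩ := Finite.exists_ne_map_eq_of_infinite (posPow a)
  wlog hlt : i < j generalizing i j
  · exact this j i hne.symm hij.symm (by omega)
  obtain ⟨d, rfl⟩ := Nat.exists_eq_add_of_lt hlt
  have h₁ : ∀ m, i ≤ m → posPow a (m + (d + 1)) = posPow a m := by
    intro m hm
    obtain rfl | hm := hm.eq_or_lt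
    · exact hij.symm
    · obtain ⟨c, rfl⟩ := Nat.exists_eq_add_of_lt hm
      rw [← posPow_mul_posPow, hij, posPow_mul_posPow]
      congr 1
      omega
  have h₂ : ∀ q m, i ≤ m → posPow a (m + q * (d + 1)) = posPow a m := by
    intro q
    induction q with
    | zero => simp
    | succ q ih =>
      intro m hm
      rw [add_mul, one_mul, ← add_assoc, h₁ _ (by omega), ih m hm]
  -- As `posPow a k` has exponent k + 1, this exponent is (i + 1)(d + 1): a multiple of the period d
  -- + 1, past the preperiod i.
  refine ⟨i * (d + 1) + d, ?_⟩
  rw [IsIdempotentElem, posPow_mul_posPow]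
  have := h₂ (i + 1) (i * (d + 1) + d) (by nlinarith)
  rw [← this]
  congr 1
  ring

/-- Lets membership in T be tested on an idempotent power. -/
theorem IsIsolatedSubsemigroup.posPow_mem_iff {T : Set S} (hT : IsIsolatedSubsemigroup T) {a : S}
    (k : ℕ) : posPow a k ∈ T ↔ a ∈ T :=
  ⟨hT.2.2 a k, fun h => posPow_mem hT.2.1 h k⟩

theorem IsIsolatedSubsemigroup.mem_of_mul_self_mem {T : Set S} (hT : IsIsolatedSubsemigroup T)
    {a : S} (h : a * a ∈ T) : a ∈ T := hT.2.2 a 1 h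

theorem eq_of_isIdempotentElem_mem_maximalSubgroup {e a : S} (ha : a ∈ maximalSubgroup e)
    (h : IsIdempotentElem a) : a = e := by
  obtain ⟨-, h₂, b, -, -, h₅, -⟩ := ha
  rw [← h₅, ← h.eq, mul_assoc, h₅, h₂, h.eq]

end Semigroup

namespace PIBar

variable {X : Type*}

instance [Finite X] : Finite (PIBar X) :=
  Finite.of_injective (fun α : PIBar X => {p : Set X × Set X | α.Joins p.1 p.2}) fun _ _ h =>
    ext_joins fun A B => Set.ext_iff.1 h (A, B)

/-! ### Maximal subgroups of corank at most one are isolated -/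

theorem codom_eq (α : PIBar X) : α.codom = {x | ∀ A ∈ α.dom, x ∉ A} := by
  ext x
  constructor
  · rintro h A ⟨B, hB⟩ hx
    exact h _ hB (by simpa using hx)
  · exact fun h C hC hx => h _ ⟨_, mem_lines_iff.1 hC⟩ hx

/-- A family that extends `E` has at most one block more if at most one point is uncovered. -/
theorem IsFamily.subset_insert [Finite X] {e : PIBar X} (he : e.corank ≤ 1) {D : Set (Set X)}
    (hD : IsFamily D) (h : e.dom ⊆ D) : D ⊆ insert e.codom e.dom := by
  intro A hA
  by_cases hAe : A ∈ e.dom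
  · exact Or.inr hAe
  · refine Or.inl (Set.eq_of_subset_of_ncard_le ?_ ?_ (Set.toFinite _))
    · intro x hx
      rw [codom_eq]
      intro B hB hx'
      exact hAe (hD.eq_of_mem hA (h hB) hx hx' ▸ hB)
    · exact he.trans ((Set.ncard_pos).2 (hD.nonempty hA))

theorem isIsolatedSubsemigroup_maximalSubgroup [Finite X] {e : PIBar X} (he : IsIdempotentElem e)
    (hc : e.corank ≤ 1) : IsIsolatedSubsemigroup (maximalSubgroup e) := by
  have hee := eq_idem_dom he
  refine ⟨⟨e, he, he, e, he, he, he, he⟩, fun a ha b hb => mul_mem_maximalSubgroup ha hb, ?_⟩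
  intro a k h
  rw [hee, mem_maximalSubgroup_idem] at h
  have hD : e.dom ⊆ a.dom := h.1 ▸ dom_posPow_subset a k
  have hR : e.dom ⊆ a.ran := h.2 ▸ ran_posPow_subset a k
  have hD' := a.isFamily_dom.subset_insert hc hD
  have hR' := a.isFamily_ran.subset_insert hc hR
  have hcard := a.ncard_dom
  -- Both families are `e.dom` with at most the block `e.codom` added; equal cardinality makes them
  -- agree. Then `a` lies in a group, whose members all have domain `a.dom`, its powers included.
  have hDR : a.dom = a.ran := by
    by_cases h₁ : e.codom ∈ a.dom
    · have hins := subset_antisymm hD' (Set.insert_subset h₁ hD)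
      exact (Set.eq_of_subset_of_ncard_le (hR'.trans hins.ge) hcard.le (Set.toFinite _)).symm
    · have hins := subset_antisymm ((Set.subset_insert_iff_of_notMem h₁).1 hD') hD
      exact Set.eq_of_subset_of_ncard_le (hins.le.trans hR) hcard.ge (Set.toFinite _)
  have ha : a ∈ maximalSubgroup (idem a.dom a.isFamily_dom) :=
    (mem_maximalSubgroup_idem _).2 ⟨rfl, hDR.symm⟩
  have hak := posPow_mem (fun a ha b hb => mul_mem_maximalSubgroup ha hb) ha k
  have hak' := ((mem_maximalSubgroup_idem _).1 hak).1
  rw [hee, mem_maximalSubgroup_idem, ← hDR, ← hak', h.1]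
  exact ⟨rfl, rfl⟩

/-! ### The symmetric group and its complement -/

theorem isFamily_singletons : IsFamily (Set.range fun x : X => ({x} : Set X)) where
  nonempty := by rintro _ ⟨x, rfl⟩; exact ⟨x, rfl⟩
  eq_of_mem := by
    rintro _ _ y ⟨x, rfl⟩ ⟨x', rfl⟩ h h'
    obtain rfl : y = x := h
    obtain rfl : y = x' := h'
    rfl

/-- The identity permutation. -/
def unit (X : Type*) : PIBar X := idem _ isFamily_singletons

theorem IsFamily.eq_of_singletons_subset {F : Set (Set X)} (hF : IsFamily F)
    (h : (Set.range fun x : X => ({x} : Set X)) ⊆ F) : F = Set.range fun x : X => ({x} : Set X) := by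
  refine subset_antisymm (fun A hA => ?_) h
  obtain ⟨x, hx⟩ := hF.nonempty hA
  exact ⟨x, hF.eq_of_mem (h ⟨x, rfl⟩) hA rfl hx⟩

/-- Pigeonhole: disjoint non-empty images of all the points of a finite set must be singletons. -/
theorem ran_eq_singletons [Finite X] {α : PIBar X}
    (h : α.dom = Set.range fun x : X => ({x} : Set X)) :
    α.ran = Set.range fun x : X => ({x} : Set X) := by
  have hex : ∀ x : X, ∃ y B, α.Joins {x} B ∧ y ∈ B := by
    intro x
    obtain ⟨B, hB⟩ : ({x} : Set X) ∈ α.dom := h ▸ ⟨x, rfl⟩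
    obtain ⟨y, hy⟩ := α.isLineRel_joins.right_nonempty hB
    exact ⟨y, B, hB, hy⟩
  choose g B hB hg using hex
  have hinj : Function.Injective g := by
    intro x x' hxx
    have := (α.isLineRel_joins.of_right (hB x) (hB x') (hg x) (hxx ▸ hg x')).1
    simpa using this
  have hsurj := Finite.surjective_of_injective hinj
  refine α.isFamily_ran.eq_of_singletons_subset ?_
  rintro _ ⟨y, rfl⟩
  obtain ⟨x, rfl⟩ := hsurj y
  refine ⟨{x}, ?_⟩
  suffices h' : B x = {g x} by
    have := hB x
    rwa [h'] at this
  refine Set.eq_singleton_iff_unique_mem.2 ⟨hg x, fun z hz => ?_⟩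
  obtain ⟨x', rfl⟩ := hsurj z
  have := (α.isLineRel_joins.of_right (hB x) (hB x') hz (hg x')).1
  rw [Set.singleton_eq_singleton_iff.1 this]

theorem segment_singleton (x y : X) : segment {x} {y} = {Sum.inl x, Sum.inr y} := by
  ext (z | z) <;> simp

theorem symmGroup_eq_maximalSubgroup [Finite X] : symmGroup X = maximalSubgroup (unit X) := by
  ext α
  rw [unit, mem_maximalSubgroup_idem]
  constructor
  · rintro ⟨g, hg⟩
    have hdom : α.dom = Set.range fun x : X => ({x} : Set X) := by
      refine α.isFamily_dom.eq_of_singletons_subset ?_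
      rintro _ ⟨x, rfl⟩
      refine ⟨{g x}, ?_⟩
      rw [Joins, segment_singleton]
      exact ⟨hg ▸ ⟨x, rfl⟩, ⟨x, by simp⟩, ⟨g x, by simp⟩⟩
    exact ⟨hdom, ran_eq_singletons hdom⟩
  · rintro ⟨hd, hr⟩
    have hex : ∀ x : X, ∃ y, α.Joins {x} {y} := by
      intro x
      obtain ⟨B, hB⟩ : ({x} : Set X) ∈ α.dom := hd ▸ ⟨x, rfl⟩
      obtain ⟨y, rfl⟩ : B ∈ Set.range fun x : X => ({x} : Set X) := hr ▸ ⟨_, hB⟩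
      exact ⟨y, hB⟩
    choose g hg using hex
    have hinj : Function.Injective g := by
      intro x x' hxx
      have h' := hg x'
      rw [← hxx] at h'
      exact Set.singleton_eq_singleton_iff.1 ((hg x).eq_left h')
    have hbij : Function.Bijective g := Finite.injective_iff_bijective.1 hinj
    refine ⟨Equiv.ofBijective g hbij, subset_antisymm ?_ ?_⟩
    · intro C hC
      obtain ⟨x, hx⟩ : ∃ x, Sum.inl x ∈ C ∨ Sum.inr (g x) ∈ C := by
        obtain ⟨p, hp⟩ := Setoid.nonempty_of_mem_partition α.rel.isPartition_classes hC
        rcases p with p | p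
        · exact ⟨p, Or.inl hp⟩
        · obtain ⟨x, rfl⟩ := hbij.2 p
          exact ⟨x, Or.inr hp⟩
      refine ⟨x, ?_⟩
      have hline := hg x
      rw [Joins, segment_singleton] at hline
      rcases hx with hx | hx
      · exact Setoid.eq_of_mem_classes hline.1 (by simp) hC hx
      · exact Setoid.eq_of_mem_classes hline.1 (by simp) hC hx
    · rintro _ ⟨x, rfl⟩
      have hline := hg x
      rw [Joins, segment_singleton] at hline
      exact hline.1

theorem corank_unit : (unit X).corank = 0 := by
  have : (unit X).codom = ∅ := by
    rw [codom_eq, unit, dom_idem]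
    ext x
    simp
  rw [corank, this, Set.ncard_empty]

theorem isIsolatedSubsemigroup_symmGroup [Finite X] : IsIsolatedSubsemigroup (symmGroup X) := by
  rw [symmGroup_eq_maximalSubgroup]
  exact isIsolatedSubsemigroup_maximalSubgroup (isIdempotentElem_idem _)
    (corank_unit.le.trans zero_le_one)

theorem isIsolatedSubsemigroup_compl_symmGroup [Finite X] [Nonempty X] :
    IsIsolatedSubsemigroup (symmGroup X)ᶜ := by
  refine ⟨⟨idem ∅ isFamily_empty, ?_⟩, ?_, ?_⟩
  · rw [symmGroup_eq_maximalSubgroup, unit, Set.mem_compl_iff, mem_maximalSubgroup_idem, dom_idem]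
    rintro ⟨h, -⟩
    exact (Set.range_nonempty _).ne_empty h.symm
  · intro a ha b _ hab
    apply ha
    rw [symmGroup_eq_maximalSubgroup, unit, mem_maximalSubgroup_idem] at hab ⊢
    -- A left factor of a permutation already has every singleton in its domain.
    have hd := a.isFamily_dom.eq_of_singletons_subset (hab.1 ▸ dom_mul_subset a b)
    exact ⟨hd, ran_eq_singletons hd⟩
  · intro a k h ha
    exact h ((isIsolatedSubsemigroup_symmGroup.posPow_mem_iff k).2 ha)

/-! ### Growing and shrinking the idempotents of an isolated subsemigroup -/

theorem idem_insert_mem {T : Set (PIBar X)} (hT : IsIsolatedSubsemigroup T) {E : Set (Set X)}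
    {A B : Set X} (hA : IsFamily (insert A E)) (hB : IsFamily (insert B E)) (hAE : A ∉ E)
    (hBE : B ∉ E) (hAB : A ≠ B) (h : idem E (hA.mono (Set.subset_insert A E)) ∈ T) :
    idem (insert A E) hA ∈ T := by
  classical
  -- The map fixes E and sends A to B. Since B is not in its domain, this line dies in the square,
  -- leaving `idem E`; the converse behaves likewise.
  have hR : IsLineRel fun C D => C ∈ insert A E ∧ (if C = A then B else C) = D := by
    refine hA.isLineRel (f := fun C => if C = A then B else C) ?_ (hB.mono ?_)
    · intro C hC D hD
      grind
    · rintro _ ⟨C, hC, rfl⟩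
      grind
  set α := ofRel _ hR
  have hαJ : ∀ C D, α.Joins C D ↔ C ∈ insert A E ∧ (if C = A then B else C) = D :=
    fun C D => joins_ofRel hR
  have h₁ : α * α = idem E (hA.mono (Set.subset_insert A E)) := ext_joins fun C D => by
    simp only [joins_mul, joins_idem, hαJ]
    grind
  have h₂ : α.converse * α.converse = idem E (hA.mono (Set.subset_insert A E)) :=
    ext_joins fun C D => by
      simp only [joins_mul, joins_idem, joins_converse, hαJ]
      grind
  have h₃ : α * α.converse = idem (insert A E) hA := by
    rw [mul_converse]
    congr 1
    ext C
    simp [dom, hαJ]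
  rw [← h₃]
  exact hT.2.1 _ (hT.mem_of_mul_self_mem (h₁ ▸ h)) _ (hT.mem_of_mul_self_mem (h₂ ▸ h))

theorem idem_diff_singleton_mem {T : Set (PIBar X)} (hT : IsIsolatedSubsemigroup T)
    {E F : Set (Set X)} (hF : IsFamily F) (hEF : E ⊆ F) {A B : Set X} (hA : A ∈ E) (hB : B ∈ F)
    (hBE : B ∉ E) (hET : idem E (hF.mono hEF) ∈ T) (hFT : idem F hF ∈ T) :
    idem (E \ {A}) (hF.mono (Set.sdiff_subset.trans hEF)) ∈ T := by
  classical
  have hmem : ∀ C ∈ F, Equiv.swap A B C ∈ F := by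
    intro C hC
    have := hEF hA
    grind
  have hR : IsLineRel fun C D => C ∈ F ∧ Equiv.swap A B C = D := by
    refine hF.isLineRel (Equiv.injective _).injOn (hF.mono ?_)
    rintro _ ⟨C, hC, rfl⟩
    exact hmem C hC
  set α := ofRel _ hR
  have hαJ : ∀ C D, α.Joins C D ↔ C ∈ F ∧ Equiv.swap A B C = D := fun C D => joins_ofRel hR
  have h₁ : α * α = idem F hF := ext_joins fun C D => by
    simp only [joins_mul, joins_idem, hαJ]
    constructor
    · rintro ⟨_, ⟨h, rfl⟩, -, rfl⟩
      simpa using h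
    · rintro ⟨h, rfl⟩
      exact ⟨_, ⟨h, rfl⟩, hmem _ h, by simp⟩
  have h₂ := hT.2.1 _ (hT.mem_of_mul_self_mem (h₁ ▸ hFT)) _ hET
  refine hT.mem_of_mul_self_mem ?_
  have h₃ := hT.2.1 _ h₂ _ h₂
  convert h₃ using 1
  rw [(isIdempotentElem_idem _).eq]
  -- In `α * idem E` the block A is lost, since its image B is not in E, while B goes to A. The
  -- square therefore loses B too and keeps exactly E \ {A}.
  refine ext_joins fun C D => ?_
  simp only [joins_mul, joins_idem, hαJ, Set.mem_sdiff, Set.mem_singleton_iff]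
  constructor
  · rintro ⟨⟨hC, hCA⟩, rfl⟩
    have hs : Equiv.swap A B C = C := Equiv.swap_apply_of_ne_of_ne hCA (by grind)
    exact ⟨C, ⟨C, ⟨hEF hC, hs⟩, hC, rfl⟩, C, ⟨hEF hC, hs⟩, hC, rfl⟩
  · rintro ⟨_, ⟨_, ⟨hC, rfl⟩, hC', rfl⟩, _, ⟨-, rfl⟩, hC'', rfl⟩
    rw [Equiv.swap_apply_self] at hC'' ⊢
    refine ⟨⟨hC'', ?_⟩, rfl⟩
    rintro rfl
    rw [Equiv.swap_apply_left] at hC'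
    exact hBE hC'

/-- Blocks are added one at a time; the uncovered point supplies the spare target {x} at every
stage. -/
theorem idem_mem_of_notMem [Finite X] {T : Set (PIBar X)} (hT : IsIsolatedSubsemigroup T)
    (h0 : idem ∅ isFamily_empty ∈ T) {F : Set (Set X)} (hF : IsFamily F) {x : X}
    (hx : ∀ A ∈ F, x ∉ A) : idem F hF ∈ T := by
  induction F, Set.toFinite F using Set.Finite.induction_on with
  | empty => exact h0
  | @insert A E hAE _ ih =>
    have hE := hF.mono (Set.subset_insert A E)
    have hxE : ∀ B ∈ E, x ∉ B := fun B hB => hx B (Or.inr hB)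
    refine idem_insert_mem hT (B := {x}) hF (hE.insert_of_disjoint ⟨x, rfl⟩ ?_) hAE ?_ ?_ (ih hE hxE)
    · rintro _ rfl
      exact hxE
    · exact fun h => hxE _ h rfl
    · rintro rfl
      exact hx _ (Or.inl rfl) rfl

theorem idem_mem_of_ne_singletons [Finite X] {T : Set (PIBar X)} (hT : IsIsolatedSubsemigroup T)
    (h0 : idem ∅ isFamily_empty ∈ T) {F : Set (Set X)} (hF : IsFamily F)
    (hne : F ≠ Set.range fun x : X => ({x} : Set X)) : idem F hF ∈ T := by
  by_cases hcov : ∃ x, ∀ A ∈ F, x ∉ A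
  · obtain ⟨x, hx⟩ := hcov
    exact idem_mem_of_notMem hT h0 hF hx
  push Not at hcov
  obtain ⟨x, hx⟩ : ∃ x, ({x} : Set X) ∉ F := by
    by_contra! h
    refine hne (hF.eq_of_singletons_subset ?_)
    rintro _ ⟨x, rfl⟩
    exact h x
  obtain ⟨A, hA, hxA⟩ := hcov x
  -- Removing the block that contains x uncovers x, so the previous lemma gives `idem E`; the block
  -- is then put back with {x} as the spare target.
  obtain ⟨E, hAE, rfl⟩ : ∃ E, A ∉ E ∧ insert A E = F :=
    ⟨F \ {A}, by simp, by simp [Set.insert_eq_of_mem hA]⟩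
  have hE := hF.mono (Set.subset_insert A E)
  have hxE : ∀ B ∈ E, x ∉ B := fun B hB hxB => hAE (hF.eq_of_mem hA (Or.inr hB) hxA hxB ▸ hB)
  refine idem_insert_mem hT (B := {x}) hF (hE.insert_of_disjoint ⟨x, rfl⟩ ?_) hAE
    (fun h => hx (Or.inr h)) ?_ (idem_mem_of_notMem hT h0 hE hxE)
  · rintro _ rfl
    exact hxE
  · rintro rfl
    exact hx hA

/-! ### The classification -/

theorem exists_idem_mem [Finite X] {T : Set (PIBar X)} (hT : IsIsolatedSubsemigroup T)
    {a : PIBar X} (ha : a ∈ T) : ∃ k, ∃ F, ∃ hF : IsFamily F, posPow a k = idem F hF ∧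
      idem F hF ∈ T := by
  obtain ⟨k, hk⟩ := exists_isIdempotentElem_posPow a
  refine ⟨k, _, _, eq_idem_dom hk, ?_⟩
  rw [← eq_idem_dom hk]
  exact (hT.posPow_mem_iff k).2 ha

/-- Closure of the idempotents under intersection turns a minimal family into a least one. -/
theorem exists_least_idem_mem [Finite X] {T : Set (PIBar X)} (hT : IsIsolatedSubsemigroup T) :
    ∃ E, ∃ hE : IsFamily E, idem E hE ∈ T ∧ ∀ F, ∀ hF : IsFamily F, idem F hF ∈ T → E ⊆ F := by
  obtain ⟨a, ha⟩ := hT.1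
  obtain ⟨-, F₀, hF₀, -, hF₀T⟩ := exists_idem_mem hT ha
  obtain ⟨E, ⟨hE, hET⟩, hmin⟩ := exists_minimal_of_wellFoundedLT
    (fun F : Set (Set X) => ∃ hF : IsFamily F, idem F hF ∈ T) ⟨F₀, hF₀, hF₀T⟩
  refine ⟨E, hE, hET, fun F hF hFT => ?_⟩
  have h := hT.2.1 _ hET _ hFT
  rw [idem_mul_idem] at h
  exact (hmin ⟨_, h⟩ Set.inter_subset_left).trans Set.inter_subset_right

theorem eq_univ_or_eq_compl_symmGroup [Finite X] {T : Set (PIBar X)}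
    (hT : IsIsolatedSubsemigroup T) (h0 : idem ∅ isFamily_empty ∈ T) :
    T = Set.univ ∨ T = (symmGroup X)ᶜ := by
  have hS := isIsolatedSubsemigroup_symmGroup (X := X)
  have hsub : (symmGroup X)ᶜ ⊆ T := by
    intro a ha
    obtain ⟨k, hk⟩ := exists_isIdempotentElem_posPow a
    -- Outside the symmetric group, the idempotent power has a family other than that of all
    -- singletons.
    rw [Set.mem_compl_iff, ← hS.posPow_mem_iff k, symmGroup_eq_maximalSubgroup, unit,
      eq_idem_dom hk, mem_maximalSubgroup_idem, dom_idem, ran_idem, and_self] at ha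
    rw [← hT.posPow_mem_iff k, eq_idem_dom hk]
    exact idem_mem_of_ne_singletons hT h0 _ ha
  by_cases hmeet : ∃ a ∈ T, a ∈ symmGroup X
  · left
    obtain ⟨a, haT, haS⟩ := hmeet
    have key : ∀ b ∈ symmGroup X, ∃ k, posPow b k = unit X := by
      intro b hb
      obtain ⟨k, hk⟩ := exists_isIdempotentElem_posPow b
      rw [← hS.posPow_mem_iff k, symmGroup_eq_maximalSubgroup] at hb
      exact ⟨k, eq_of_isIdempotentElem_mem_maximalSubgroup hb hk⟩
    obtain ⟨k, hk⟩ := key a haS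
    rw [← hT.posPow_mem_iff k, hk] at haT
    refine Set.eq_univ_of_forall fun b => ?_
    by_cases hb : b ∈ symmGroup X
    · obtain ⟨l, hl⟩ := key b hb
      rwa [← hT.posPow_mem_iff l, hl]
    · exact hsub hb
  · right
    exact subset_antisymm (fun a ha ha' => hmeet ⟨a, ha, ha'⟩) hsub

theorem IsIsolatedSubsemigroup.classification [Finite X] {T : Set (PIBar X)}
    (hT : IsIsolatedSubsemigroup T) : T = Set.univ ∨ T = (symmGroup X)ᶜ ∨
      ∃ e : PIBar X, IsIdempotentElem e ∧ e.corank ≤ 1 ∧ T = maximalSubgroup e := by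
  obtain ⟨E, hE, hET, hmin⟩ := exists_least_idem_mem hT
  obtain rfl | ⟨A, hA⟩ := E.eq_empty_or_nonempty
  · exact (eq_univ_or_eq_compl_symmGroup hT hET).imp_right Or.inl
  have huniq : ∀ F, ∀ hF : IsFamily F, idem F hF ∈ T → F = E := by
    intro F hF hFT
    have hEF := hmin F hF hFT
    refine subset_antisymm (fun B hB => ?_) hEF
    by_contra hBE
    -- Shrinking would put E \ {A} into T, against E being least.
    exact (hmin _ _ (idem_diff_singleton_mem hT hF hEF hA hB hBE hET hFT) hA).2 rfl
  have hc : (idem E hE).corank ≤ 1 := by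
    refine (Set.ncard_le_one_iff (Set.toFinite _)).2 fun {x y} hx hy => ?_
    rw [codom_eq, dom_idem] at hx hy
    by_contra hxy
    have hins : ∀ z : X, (∀ A ∈ E, z ∉ A) → IsFamily (insert {z} E) := by
      intro z hz
      refine hE.insert_of_disjoint ⟨z, rfl⟩ ?_
      rintro _ rfl
      exact hz
    have hxE : {x} ∉ E := fun h => hx _ h rfl
    -- With two uncovered points, {y} is a spare target for adding {x}, contradicting uniqueness of
    -- E.
    have h := idem_insert_mem hT (hins x hx) (hins y hy) hxE (fun h => hy _ h rfl)
      (by simpa using hxy) hET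
    exact hxE (huniq _ _ h ▸ Or.inl rfl)
  have hI := isIdempotentElem_idem hE
  refine Or.inr (Or.inr ⟨_, hI, hc, ?_⟩)
  have hG := isIsolatedSubsemigroup_maximalSubgroup hI hc
  ext a
  constructor
  · intro ha
    obtain ⟨k, F, hF, hk, hFT⟩ := exists_idem_mem hT ha
    obtain rfl := huniq F hF hFT
    rw [← hG.posPow_mem_iff k, hk, mem_maximalSubgroup_idem, dom_idem, ran_idem]
    exact ⟨rfl, rfl⟩
  · intro ha
    obtain ⟨k, hk⟩ := exists_isIdempotentElem_posPow a
    rw [← hG.posPow_mem_iff k] at ha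
    rwa [← hT.posPow_mem_iff k, eq_of_isIdempotentElem_mem_maximalSubgroup ha hk]

end PIBar

theorem mainTheorem10 (n : ℕ) (hn : 2 ≤ n) (T : Set (PIBar (Fin n))) :
    IsIsolatedSubsemigroup T ↔
      T = Set.univ ∨ T = PIBar.symmGroup (Fin n) ∨ T = (PIBar.symmGroup (Fin n))ᶜ ∨
        ∃ e : PIBar (Fin n), IsIdempotentElem e ∧ e.corank ≤ 1 ∧ T = maximalSubgroup e := by
  have : Nonempty (Fin n) := ⟨⟨0, by omega⟩⟩
  constructor
  · intro h
    rcases PIBar.IsIsolatedSubsemigroup.classification h with h | h | h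
    · exact Or.inl h
    · exact Or.inr (Or.inr (Or.inl h))
    · exact Or.inr (Or.inr (Or.inr h))
  · rintro (rfl | rfl | rfl | ⟨e, he, hc, rfl⟩)
    · exact ⟨⟨PIBar.unit _, trivial⟩, fun _ _ _ _ => trivial, fun _ _ _ => trivial⟩
    · exact PIBar.isIsolatedSubsemigroup_symmGroup
    · exact PIBar.isIsolatedSubsemigroup_compl_symmGroup
    · exact PIBar.isIsolatedSubsemigroup_maximalSubgroup he hc
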